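/- Let $\mathcal Q$ be a small quantaloid, i.e. a small category whose hom-sets are complete lattices and whose composition preserves arbitrary joins in each variable. A small $\mathcal Q$-category $(X,a)$ consists of a set $X$, an object $|x|$ of $\mathcal Q$ for every $x\in X$, and morphisms $a(x,y):|x|\to|y|$ in $\mathcal Q$ $(x,y\in X)$ with $1_{|x|}\le a(x,x)$ and $a(y,z)\circ a(x,y)\le a(x,z)$ for all $x,y,z\in X$. A $\mathcal Q$-functor $f:(X,a)\to(Y,b)$ is a map $f:X\to Y$ with $|x|=|f(x)|$ and $a(x,y)\le b(f(x),f(y))$ for all $x,y\in X$. Let $\mathcal Q\text{-}\mathbf{Cat}$ be the (ordinary) category of small $\mathcal Q$-categories and $\mathcal Q$-functors. A category $\mathcal C$ with small hom-sets is called - totally cocomplete, if every diagram $D:\mathcal J\to\mathcal C$ (with $\mathcal J$ of arbitrary size) has a colimit in $\mathcal C$ whenever the colimit of $\mathcal C(A,D-)$ exists in $\mathbf{Set}$ for all objects $A$ of $\mathcal C$; - hypercomplete, if every diagram $D:\mathcal J\to\mathcal C$ (with $\mathcal J$ of arbitrary size) has a limit in $\mathcal C$ whenever the limit of $\mathcal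 C(A,D-)$ exists in $\mathbf{Set}$ for all objects $A$ of $\mathcal C$; - totally complete, respectively hypercocomplete, if $\mathcal C^{\mathrm{op}}$ is totally cocomplete, respectively hypercomplete. **Theorem.** For every small quantaloid $\mathcal Q$, the category $\mathcal Q\text{-}\mathbf{Cat}$ is totally complete and totally cocomplete and, in particular, hypercocomplete and hypercomplete. -/

import Mathlib

open CategoryTheory CategoryTheory.Limits Opposite

universe w₁ w₂ v u

/-- A quantaloid: a category enriched in complete lattices and sup-preserving maps, i.e. every
hom-set is a complete lattice and composition preserves arbitrary joins in each variable.
It is small when both universe levels agree. -/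
class Quantaloid (Q : Type u) extends Category.{v} Q where
  homLattice (p q : Q) : CompleteLattice (p ⟶ q)
  sSup_comp {p q r : Q} (S : Set (p ⟶ q)) (g : q ⟶ r) : sSup S ≫ g = ⨆ f ∈ S, f ≫ g
  comp_sSup {p q r : Q} (f : p ⟶ q) (S : Set (q ⟶ r)) : f ≫ sSup S = ⨆ g ∈ S, f ≫ g

attribute [reducible, instance] Quantaloid.homLattice

/-- A small `Q`-category: a set of objects, each with an extent in `Q`, and hom-arrows in `Q`
between the extents. (`f ≫ g` is composition in diagrammatic order, i.e. `g ∘ f`.) -/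
structure QCat (Q : Type u) [Quantaloid.{u, u} Q] where
  carrier : Type u
  extent : carrier → Q
  arrow (x y : carrier) : extent x ⟶ extent y
  id_le (x : carrier) : 𝟙 (extent x) ≤ arrow x x
  comp_le (x y z : carrier) : arrow x y ≫ arrow y z ≤ arrow x z

namespace QCat

variable {Q : Type u} [Quantaloid.{u, u} Q]

/-- A `Q`-functor: an extent-preserving map `f` with `a (x, y) ≤ b (f x, f y)`. The arrows
`eqToHom _` are the identities of `Q` that identify equal extents. -/
@[ext]
structure QFunctor (X Y : QCat Q) where
  toFun : X.carrier → Y.carrier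
  extent_eq (x : X.carrier) : X.extent x = Y.extent (toFun x)
  arrow_le (x y : X.carrier) :
    X.arrow x y ≤
      eqToHom (extent_eq x) ≫ Y.arrow (toFun x) (toFun y) ≫ eqToHom (extent_eq y).symm

theorem comp_le_comp_left {p q r : Q} (f : p ⟶ q) {g h : q ⟶ r} (hgh : g ≤ h) :
    f ≫ g ≤ f ≫ h := by
  have e : h = sSup {g, h} := by rw [sSup_pair]; exact (sup_eq_right.mpr hgh).symm
  rw [e, Quantaloid.comp_sSup]
  exact le_iSup₂_of_le g (by simp) le_rfl

theorem comp_le_comp_right {p q r : Q} {f g : p ⟶ q} (hfg : f ≤ g) (h : q ⟶ r) :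
    f ≫ h ≤ g ≫ h := by
  have e : g = sSup {f, g} := by rw [sSup_pair]; exact (sup_eq_right.mpr hfg).symm
  rw [e, Quantaloid.sSup_comp]
  exact le_iSup₂_of_le f (by simp) le_rfl

/-- The identity `Q`-functor. -/
def QFunctor.id (X : QCat Q) : QFunctor X X where
  toFun x := x
  extent_eq _ := rfl
  arrow_le x y := by simp

/-- Composition of `Q`-functors is composition of the underlying maps. -/
def QFunctor.comp {X Y Z : QCat Q} (f : QFunctor X Y) (g : QFunctor Y Z) : QFunctor X Z where
  toFun x := g.toFun (f.toFun x)
  extent_eq x := (f.extent_eq x).trans (g.extent_eq (f.toFun x))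
  arrow_le x y := by
    refine (f.arrow_le x y).trans ?_
    have h := comp_le_comp_left (eqToHom (f.extent_eq x))
      (comp_le_comp_right (g.arrow_le (f.toFun x) (f.toFun y)) (eqToHom (f.extent_eq y).symm))
    simpa using h

/-- The category of small `Q`-categories and `Q`-functors. -/
instance : Category.{u} (QCat Q) where
  Hom X Y := QFunctor X Y
  id X := QFunctor.id X
  comp f g := QFunctor.comp f g

end QCat

section Totality

variable (C : Type u) [Category.{v} C]

/-- `C` is hypercomplete (for diagrams over categories `J` in the given universes, which may be
arbitrarily large): `D : J ⥤ C` has a limit whenever the limit of `C(A, D-)` exists in the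
category of (small) sets for all objects `A`. -/
def IsHypercomplete : Prop :=
  ∀ (J : Type w₁) [Category.{w₂} J] (D : J ⥤ C),
    (∀ A : C, HasLimit (D ⋙ coyoneda.obj (op A))) → HasLimit D

/-- `C` is totally cocomplete: `D : J ⥤ C` has a colimit whenever the colimit of `C(A, D-)`
exists in the category of (small) sets for all objects `A`. -/
def IsTotallyCocomplete : Prop :=
  ∀ (J : Type w₁) [Category.{w₂} J] (D : J ⥤ C),
    (∀ A : C, HasColimit (D ⋙ coyoneda.obj (op A))) → HasColimit D

/-- `C` is hypercocomplete, the dual of hypercomplete: `D : J ⥤ C` has a colimit whenever the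
limit of `C(D-, A)` exists in the category of (small) sets for all objects `A`. -/
def IsHypercocomplete : Prop :=
  ∀ (J : Type w₁) [Category.{w₂} J] (D : J ⥤ C),
    (∀ A : C, HasLimit (D.op ⋙ yoneda.obj A)) → HasColimit D

/-- `C` is totally complete, the dual of totally cocomplete: `D : J ⥤ C` has a limit whenever the
colimit of `C(D-, A)` exists in the category of (small) sets for all objects `A`. -/
def IsTotallyComplete : Prop :=
  ∀ (J : Type w₁) [Category.{w₂} J] (D : J ⥤ C),
    (∀ A : C, HasColimit (D.op ⋙ yoneda.obj A)) → HasLimit D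

end Totality

namespace QCat

variable {Q : Type u} [Quantaloid.{u, u} Q]

/-! Since the hom-lattices of `Q` are complete, an infimum over a family of any size gives an
initial structure (`initialLift`). Hence limits and colimits of `Q`-categories can be built on the
limit or colimit of the underlying sets over `Q`, and only the smallness of that set is at stake.
The points on objects of `Q` detect elements, and the indiscrete `Q`-category on `Q × Prop` detects
subsets. Testing the hypothesis on homs out of the points, or into the classifier, bounds the set in
each of the four cases. -/

theorem hom_ext {X Y : QCat Q} {f g : X ⟶ Y}
    (h : ∀ x, QFunctor.toFun f x = QFunctor.toFun g x) : f = g :=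
  QFunctor.ext (funext h)

theorem toFun_congr {X Y : QCat Q} {f g : X ⟶ Y} (h : f = g) (x : X.carrier) :
    QFunctor.toFun f x = QFunctor.toFun g x := by rw [h]

/-- The arrow `Y.arrow y y'` regarded as an arrow between objects equal to the extents. -/
def castArrow (Y : QCat Q) {p p' : Q} {y y' : Y.carrier} (h : p = Y.extent y)
    (h' : p' = Y.extent y') : p ⟶ p' :=
  eqToHom h ≫ Y.arrow y y' ≫ eqToHom h'.symm

theorem id_le_castArrow (Y : QCat Q) {p : Q} {y : Y.carrier} (h : p = Y.extent y) :
    𝟙 p ≤ Y.castArrow h h := by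
  subst h
  simpa [castArrow] using Y.id_le y

theorem castArrow_comp_le (Y : QCat Q) {p p' p'' : Q} {y y' y'' : Y.carrier}
    (h : p = Y.extent y) (h' : p' = Y.extent y') (h'' : p'' = Y.extent y'') :
    Y.castArrow h h' ≫ Y.castArrow h' h'' ≤ Y.castArrow h h'' := by
  subst h h' h''
  simpa [castArrow] using Y.comp_le y y' y''

theorem castArrow_le_castArrow {X Y : QCat Q} (f : QFunctor X Y) {p p' : Q} {x x' : X.carrier}
    (h : p = X.extent x) (h' : p' = X.extent x') :
    X.castArrow h h' ≤
      Y.castArrow (h.trans (f.extent_eq x)) (h'.trans (f.extent_eq x')) := by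
  subst h h'
  simpa [castArrow] using f.arrow_le x x'

/-- The initial lift of a family of extent-preserving maps of arbitrary size: the largest
`Q`-category structure making all of them `Q`-functors. -/
def initialLift {X : Type u} (e : X → Q) {ι : Sort*} (Y : ι → QCat Q)
    (g : ∀ i, X → (Y i).carrier) (hg : ∀ i x, e x = (Y i).extent (g i x)) : QCat Q where
  carrier := X
  extent := e
  arrow x y := ⨅ i, (Y i).castArrow (hg i x) (hg i y)
  id_le x := le_iInf fun i => (Y i).id_le_castArrow (hg i x)
  comp_le x y z := le_iInf fun i =>
    ((comp_le_comp_left _ (iInf_le _ i)).trans (comp_le_comp_right (iInf_le _ i) _)).trans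
      ((Y i).castArrow_comp_le (hg i x) (hg i y) (hg i z))

section InitialLift

variable {X : Type u} (e : X → Q) {ι : Sort*} (Y : ι → QCat Q)
  (g : ∀ i, X → (Y i).carrier) (hg : ∀ i x, e x = (Y i).extent (g i x))

/-- The members of the lifted family as `Q`-functors. -/
def initialLiftProj (i : ι) : initialLift e Y g hg ⟶ Y i :=
  QFunctor.mk (X := initialLift e Y g hg) (g i) (hg i) fun _ _ => iInf_le _ i

/-- A map into the initial lift is a `Q`-functor if all its composites are. -/
def initialLiftLift {A : QCat Q} (f : A.carrier → X) (hf : ∀ x, A.extent x = e (f x))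
    (k : ∀ i, A ⟶ Y i) (hk : ∀ i x, QFunctor.toFun (k i) x = g i (f x)) :
    A ⟶ initialLift e Y g hg :=
  QFunctor.mk (Y := initialLift e Y g hg) f hf fun x y => by
    -- The extents are generalised to variables so that the equalities can be eliminated.
    have key : ∀ {p p' : Q} (h : A.extent x = p) (h' : A.extent y = p') (a : p ⟶ p'),
        eqToHom h.symm ≫ A.arrow x y ≫ eqToHom h' ≤ a →
          A.arrow x y ≤ eqToHom h ≫ a ≫ eqToHom h'.symm := by
      rintro _ _ rfl rfl a ha
      simpa using ha
    refine key (hf x) (hf y) _ (le_iInf fun i => ?_)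
    have := castArrow_le_castArrow (k i) (hf x).symm (hf y).symm
    simp only [hk i] at this
    exact this

end InitialLift

/-- The one-object `Q`-category with only the identity arrow on `q`. -/
def point (q : Q) : QCat Q where
  carrier := PUnit
  extent _ := q
  arrow _ _ := 𝟙 q
  id_le _ := le_rfl
  comp_le _ _ _ := by simp

/-- The `Q`-functor from a point that names an object. -/
def pointHom {q : Q} {X : QCat Q} (x : X.carrier) (h : q = X.extent x) : point q ⟶ X :=
  QFunctor.mk (X := point q) (fun _ => x) (fun _ => h) fun _ _ => X.id_le_castArrow h

/-- The indiscrete `Q`-category in which every extent is taken by two objects. It classifies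
subsets of the set of objects. -/
def subsetClassifier (Q : Type u) [Quantaloid.{u, u} Q] : QCat Q :=
  initialLift (X := Q × ULift.{u} Prop) Prod.fst (ι := PEmpty.{1}) (fun i => i.elim)
    (fun i => i.elim) (fun i => i.elim)

/-- The characteristic `Q`-functor of a predicate on objects. -/
def charHom (X : QCat Q) (P : X.carrier → Prop) : X ⟶ subsetClassifier Q :=
  initialLiftLift _ _ _ _ (fun x => (X.extent x, ULift.up (P x))) (fun _ => rfl)
    (fun i => i.elim) (fun i => i.elim)

/-- The functor to sets that forgets the extents and the arrows. -/
def forgetToType (Q : Type u) [Quantaloid.{u, u} Q] : QCat Q ⥤ Type u where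
  obj X := X.carrier
  map f := ↾(QFunctor.toFun f)

section Diagram

variable {J : Type w₁} [Category.{w₂} J] (D : J ⥤ QCat Q)

/-- The objects of the prospective limit of `D`: compatible families of objects of a common
extent. -/
@[ext]
structure CompatibleFamily where
  extent : Q
  obj (j : J) : (D.obj j).carrier
  extent_eq (j : J) : extent = (D.obj j).extent (obj j)
  map_obj {j j' : J} (f : j ⟶ j') : QFunctor.toFun (D.map f) (obj j) = obj j'

/-- The compatible family traced out by an object of the apex of a cone. -/
def CompatibleFamily.ofCone (s : Cone D) (x : s.pt.carrier) : CompatibleFamily D where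
  extent := s.pt.extent x
  obj j := QFunctor.toFun (s.π.app j) x
  extent_eq j := QFunctor.extent_eq (s.π.app j) x
  map_obj f := toFun_congr (s.w f) x

/-- The limit carries the initial structure along the projections. As the extent is part of a
family, empty `J` gives the carrier `Q`, as the terminal object requires. -/
theorem hasLimit_of_small_compatibleFamily [Small.{u} (CompatibleFamily D)] : HasLimit D := by
  let E := (equivShrink (CompatibleFamily D)).symm
  let g : ∀ j, Shrink.{u} (CompatibleFamily D) → (D.obj j).carrier := fun j x => (E x).obj j
  let e : Shrink.{u} (CompatibleFamily D) → Q := fun x => (E x).extent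
  have hg : ∀ j x, e x = (D.obj j).extent (g j x) := fun j x => (E x).extent_eq j
  let c : Cone D :=
    { pt := initialLift e D.obj g hg
      π :=
        { app j := initialLiftProj e D.obj g hg j
          naturality _ _ f := hom_ext fun x => ((E x).map_obj f).symm } }
  refine ⟨⟨c, ?_⟩⟩
  exact
    { lift s := initialLiftLift e D.obj g hg (fun x => E.symm (CompatibleFamily.ofCone D s x))
        (fun x => by simp [e, CompatibleFamily.ofCone]) s.π.app
        (fun j x => by simp [g, CompatibleFamily.ofCone])
      fac s j := hom_ext fun x =>
        show (E (E.symm (CompatibleFamily.ofCone D s x))).obj j = _ by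
          rw [Equiv.apply_symm_apply]; rfl
      uniq s m hm := hom_ext fun x =>
        show QFunctor.toFun m x = E.symm (CompatibleFamily.ofCone D s x) from
          (Equiv.eq_symm_apply E).mpr (CompatibleFamily.ext (QFunctor.extent_eq m x).symm
            (funext fun j => toFun_congr (hm j) x)) }

/-- The extent of an object of the prospective colimit of `D`. -/
def colimitExtent : (D ⋙ forgetToType Q).ColimitType → Q :=
  (D ⋙ forgetToType Q).descColimitType
    { pt := Q
      ι j x := (D.obj j).extent x
      ι_naturality f := funext fun x => (QFunctor.extent_eq (D.map f) x).symm }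

/-- The map from the prospective colimit of `D` to the apex of a cocone. -/
def colimitDesc (s : Cocone D) : (D ⋙ forgetToType Q).ColimitType → s.pt.carrier :=
  (D ⋙ forgetToType Q).descColimitType
    { pt := s.pt.carrier
      ι j x := QFunctor.toFun (s.ι.app j) x
      ι_naturality f := funext fun x => toFun_congr (s.w f) x }

theorem extent_colimitDesc (s : Cocone D) (x : (D ⋙ forgetToType Q).ColimitType) :
    colimitExtent D x = s.pt.extent (colimitDesc D s x) := by
  obtain ⟨j, x, rfl⟩ := (D ⋙ forgetToType Q).ιColimitType_jointly_surjective x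
  exact QFunctor.extent_eq (s.ι.app j) x

/-- The structure is initial along the maps to the apexes of all cocones, a large family. The
coprojections are `Q`-functors because their composites with these maps are the legs of the cocones.
-/
theorem hasColimit_of_small_colimitType [Small.{u} (D ⋙ forgetToType Q).ColimitType] :
    HasColimit D := by
  let T := (D ⋙ forgetToType Q).ColimitType
  let E := (equivShrink T).symm
  let e : Shrink.{u} T → Q := fun x => colimitExtent D (E x)
  let g : ∀ s : Cocone D, Shrink.{u} T → s.pt.carrier := fun s x => colimitDesc D s (E x)
  have hg : ∀ (s : Cocone D) x, e x = s.pt.extent (g s x) := fun s x => extent_colimitDesc D s (E x)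
  let c : Cocone D :=
    { pt := initialLift e (fun s : Cocone D => s.pt) g hg
      ι :=
        { app j := initialLiftLift e (fun s : Cocone D => s.pt) g hg
            (fun x => E.symm ((D ⋙ forgetToType Q).ιColimitType j x))
            (fun x => by simp only [e, Equiv.apply_symm_apply]; rfl)
            (fun s : Cocone D => s.ι.app j)
            (fun s x => by simp only [g, Equiv.apply_symm_apply]; rfl)
          naturality i j f := hom_ext fun x =>
            congrArg E.symm ((D ⋙ forgetToType Q).ιColimitType_map f x) } }
  refine ⟨⟨c, ?_⟩⟩
  exact
    { desc s := initialLiftProj e (fun s : Cocone D => s.pt) g hg s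
      fac s j := hom_ext fun x =>
        show colimitDesc D s (E (E.symm ((D ⋙ forgetToType Q).ιColimitType j x))) = _ by
          rw [Equiv.apply_symm_apply]; rfl
      uniq s m hm := hom_ext fun (x : Shrink.{u} T) =>
        show QFunctor.toFun m x = colimitDesc D s (E x) by
          obtain ⟨y, rfl⟩ := E.symm.surjective x
          rw [Equiv.apply_symm_apply]
          obtain ⟨j, y, rfl⟩ := (D ⋙ forgetToType Q).ιColimitType_jointly_surjective y
          exact toFun_congr (hm j) y }

/-- A section at `point q` is a compatible family of extent `q`, and `q` ranges over a small set. -/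
theorem small_compatibleFamily_of_small_sections
    (h : ∀ A : QCat Q, Small.{u} (D ⋙ coyoneda.obj (op A)).sections) :
    Small.{u} (CompatibleFamily D) := by
  have (q : Q) := h (point q)
  let φ : (Σ q : Q, (D ⋙ coyoneda.obj (op (point q))).sections) → CompatibleFamily D :=
    fun s =>
      { extent := s.1
        obj j := QFunctor.toFun (X := point s.1) (s.2.1 j) PUnit.unit
        extent_eq j := QFunctor.extent_eq (X := point s.1) (s.2.1 j) PUnit.unit
        map_obj f := toFun_congr (X := point s.1) (s.2.2 f) PUnit.unit }
  refine small_of_surjective (f := φ) fun x => ?_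
  exact ⟨⟨x.extent, fun j => pointHom (x.obj j) (x.extent_eq j),
    fun f => hom_ext fun _ => x.map_obj f⟩, rfl⟩

/-- A family is determined by its extent and by evaluation at it, a function between small sets. -/
theorem small_compatibleFamily_of_small_colimitType
    (h : ∀ A : QCat Q, Small.{u} (D.op ⋙ yoneda.obj A).ColimitType) :
    Small.{u} (CompatibleFamily D) := by
  let A := subsetClassifier Q
  have := h A
  let ev (x : CompatibleFamily D) : (D.op ⋙ yoneda.obj A).ColimitType → A.carrier :=
    (D.op ⋙ yoneda.obj A).descColimitType
      { pt := A.carrier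
        ι j f := QFunctor.toFun (Y := A) f (x.obj j.unop)
        ι_naturality k := funext fun f =>
          congrArg (QFunctor.toFun (Y := A) f) (x.map_obj k.unop) }
  refine small_of_injective (f := fun x : CompatibleFamily D => (x.extent, ev x)) fun x y hxy => ?_
  obtain ⟨h₁, h₂⟩ := Prod.mk.inj hxy
  refine CompatibleFamily.ext h₁ (funext fun j => ?_)
  -- The characteristic functor of the singleton `{y.obj j}` separates `x.obj j` from `y.obj j`
  -- unless they agree.
  have h₃ := congrFun h₂ ((D.op ⋙ yoneda.obj A).ιColimitType (op j)
    (charHom (D.obj j) fun z => z = y.obj j))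
  have h₄ : (x.obj j = y.obj j) = (y.obj j = y.obj j) :=
    congrArg (fun a : Q × ULift.{u} Prop => a.2.down) h₃
  exact h₄.mpr rfl

/-- Every element of the colimit is represented by an object of some `D.obj j`, hence by a point of
its extent. -/
theorem small_colimitType_of_small_colimitType
    (h : ∀ A : QCat Q, Small.{u} (D ⋙ coyoneda.obj (op A)).ColimitType) :
    Small.{u} (D ⋙ forgetToType Q).ColimitType := by
  have (q : Q) := h (point q)
  let φ : (Σ q : Q, (D ⋙ coyoneda.obj (op (point q))).ColimitType) →
      (D ⋙ forgetToType Q).ColimitType := fun s =>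
    (D ⋙ coyoneda.obj (op (point s.1))).descColimitType
      { pt := (D ⋙ forgetToType Q).ColimitType
        ι j f := (D ⋙ forgetToType Q).ιColimitType j
          (QFunctor.toFun (X := point s.1) f PUnit.unit)
        ι_naturality k := funext fun f => (D ⋙ forgetToType Q).ιColimitType_map k
          (QFunctor.toFun (X := point s.1) f PUnit.unit) } s.2
  refine small_of_surjective (f := φ) fun x => ?_
  obtain ⟨j, x, rfl⟩ := (D ⋙ forgetToType Q).ιColimitType_jointly_surjective x
  exact ⟨⟨(D.obj j).extent x, (D ⋙ coyoneda.obj (op (point _))).ιColimitType j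
    (pointHom (X := D.obj j) x rfl)⟩, rfl⟩

/-- The preimages of `{t}` in all `D.obj j` form a section, which determines `t` by joint
surjectivity. -/
theorem small_colimitType_of_small_sections
    (h : ∀ A : QCat Q, Small.{u} (D.op ⋙ yoneda.obj A).sections) :
    Small.{u} (D ⋙ forgetToType Q).ColimitType := by
  have := h (subsetClassifier Q)
  let F := D ⋙ forgetToType Q
  let χ (t : F.ColimitType) : (D.op ⋙ yoneda.obj (subsetClassifier Q)).sections :=
    ⟨fun j => charHom (D.obj j.unop) fun z => F.ιColimitType j.unop z = t, by
      intro i j f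
      refine hom_ext fun z => Prod.ext (QFunctor.extent_eq (D.map f.unop) z).symm (ULift.ext _ _ ?_)
      exact congrArg (· = t) (F.ιColimitType_map f.unop z)⟩
  refine small_of_injective (f := χ) fun t t' htt => ?_
  obtain ⟨j, y, rfl⟩ := F.ιColimitType_jointly_surjective t
  have h₁ := toFun_congr (congrFun (congrArg Subtype.val htt) (op j)) y
  have h₂ : (F.ιColimitType j y = F.ιColimitType j y) = (F.ιColimitType j y = t') :=
    congrArg (fun a : Q × ULift.{u} Prop => a.2.down) h₁
  exact h₂.mp rfl

end Diagram

end QCat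

theorem mainTheorem2 (Q : Type u) [Quantaloid.{u, u} Q] :
    IsTotallyComplete.{w₁, w₂} (QCat Q) ∧
    IsTotallyCocomplete.{w₁, w₂} (QCat Q) ∧
    IsHypercocomplete.{w₁, w₂} (QCat Q) ∧
    IsHypercomplete.{w₁, w₂} (QCat Q) := by
  refine ⟨fun J _ D h => ?_, fun J _ D h => ?_, fun J _ D h => ?_, fun J _ D h => ?_⟩
  · have := QCat.small_compatibleFamily_of_small_colimitType D fun A =>
      (Types.hasColimit_iff_small_colimitType _).mp (h A)
    exact QCat.hasLimit_of_small_compatibleFamily D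
  · have := QCat.small_colimitType_of_small_colimitType D fun A =>
      (Types.hasColimit_iff_small_colimitType _).mp (h A)
    exact QCat.hasColimit_of_small_colimitType D
  · have := QCat.small_colimitType_of_small_sections D fun A =>
      (Types.hasLimit_iff_small_sections _).mp (h A)
    exact QCat.hasColimit_of_small_colimitType D
  · have := QCat.small_compatibleFamily_of_small_sections D fun A =>
      (Types.hasLimit_iff_small_sections _).mp (h A)
    exact QCat.hasLimit_of_small_compatibleFamily D
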